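/- A \emph{solution} is a pair $(X,r)$, where $X$ is a nonempty set and $r:X\times X\to X\times X$, $r(x,y)=({}^xy,x^y)$, is an involutive map satisfying the braid relation $r^{12}r^{23}r^{12}=r^{23}r^{12}r^{23}$ on $X^3$ and non-degenerate, i.e. the maps $\mathcal L_x:y\mapsto{}^xy$ and $\mathcal R_y:x\mapsto x^y$ are bijective for all $x,y\in X$. It is \emph{square-free} if $r(x,x)=(x,x)$ for all $x$, and \emph{nontrivial} if $r$ is not the flip $(x,y)\mapsto(y,x)$. Its \emph{retraction} $\mathrm{Ret}(X,r)$ is the solution induced by $r$ on the quotient of $X$ by the equivalence relation $x\sim y\iff\mathcal L_x=\mathcal L_y$; $\mathrm{Ret}^0(X,r)=(X,r)$ and $\mathrm{Ret}^{j}(X,r)=\mathrm{Ret}(\mathrm{Ret}^{j-1}(X,r))$. The \emph{multipermutation level} $\mathrm{mpl}\,X$ is the least $m\ge 0$ such that $\mathrm{Ret}^m(X,r)$ has exactly one element, and $\infty$ if there is no such $m$. Let $G=G(X,r)$ be the group generated by $X$ with relations $xy=({}^xy)(x^y)$, $x,y\in X$, and let $\mathcal G=\mathcal G(X,r)$ be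 the image of the homomorphism $\mathcal L:G\to\mathrm{Sym}(X)$ extending $x\mapsto\mathcal L_x$. A \emph{symmetric group} (in the sense of Takeuchi) is a group $H$ with an involutive map $\sigma:H\times H\to H\times H$, $\sigma(a,b)=({}^ab,a^b)$, which makes $(H,H,\sigma)$ a matched pair of groups and satisfies $ab=({}^ab)(a^b)$ for all $a,b\in H$. There is a unique $r_G$ such that $(G,r_G)$ is a symmetric group and $r_G$ extends $r$ on the generators, and a unique $r_{\mathcal G}$ such that $(\mathcal G,r_{\mathcal G})$ is a symmetric group and $r_{\mathcal G}\circ(\mathcal L\times\mathcal L)=(\mathcal L\times\mathcal L)\circ r_G$. For $j\ge 0$ the \emph{derived permutation group} of $(X,r)$ is the symmetric group $(\mathcal G_j,r_{\mathcal G_j})=\mathcal G(\mathrm{Ret}^j(X,r))$ so obtained from $\mathrm{Ret}^j(X,r)$. It satisfies condition \textbf{lri} if, for the actions given by $r_{\mathcal G_j}$, one has $({}^ab)^a=b={}^a(b^a)$ for all $a,b\in\mathcal G_j$. \textbf{Corollary.} Let $(X,r)$ be a finite nontrivial square-free solution. The following conditions are equivalent: (1) $2\le\mathrm{mpl}\,X<\infty$;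 (2) there exists an integer $j\ge 0$ such that the derived permutation group $(\mathcal G_j,r_{\mathcal G_j})$ satisfies \textbf{lri} and $\mathcal G_j\ne\{1\}$. -/

import Mathlib

universe u v

/-- A *solution* (non-degenerate symmetric set): a nonempty set `X` with an involutive,
non-degenerate map `r : X × X → X × X` satisfying the braid relation.
We write `r (x, y) = (ˣy, xʸ)`. -/
structure SymmetricSet where
  carrier : Type u
  nonempty : Nonempty carrier
  r : carrier × carrier → carrier × carrier
  /-- `r` is involutive (in particular bijective). -/
  invol : ∀ p, r (r p) = p
  /-- The maps `y ↦ ˣy` are bijective. -/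
  left_bijective : ∀ x, Function.Bijective fun y => (r (x, y)).1
  /-- The maps `x ↦ xʸ` are bijective. -/
  right_bijective : ∀ y, Function.Bijective fun x => (r (x, y)).2
  /-- The braid relation `r¹² r²³ r¹² = r²³ r¹² r²³` on `X × X × X`. -/
  braid :
    let r12 : carrier × carrier × carrier → carrier × carrier × carrier :=
      fun p => ((r (p.1, p.2.1)).1, (r (p.1, p.2.1)).2, p.2.2)
    let r23 : carrier × carrier × carrier → carrier × carrier × carrier :=
      fun p => (p.1, r p.2)
    r12 ∘ r23 ∘ r12 = r23 ∘ r12 ∘ r23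

/-- Condition **lri** for a map `σ (x, y) = (ˣy, xʸ)`: `(ˣy)ˣ = y = ˣ(yˣ)` for all `x, y`. -/
def SatisfiesLRI {H : Type v} (σ : H × H → H × H) : Prop :=
  ∀ x y : H, (σ ((σ (x, y)).1, x)).2 = y ∧ (σ (x, (σ (y, x)).2)).1 = y

/-- `(H, σ)` is a *symmetric group* in the sense of Takeuchi: writing `σ (a, b) = (ᵃb, aᵇ)`,
the map `σ` makes `(H, H)` a matched pair of groups, `ab = (ᵃb)(aᵇ)`, and `σ` is involutive. -/
structure IsSymmetricGroup {H : Type v} [Group H] (σ : H × H → H × H) : Prop where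
  bij : Function.Bijective σ
  ml0 : ∀ a, (σ (a, 1)).1 = 1
  ml0' : ∀ u, (σ (1, u)).1 = u
  mr0 : ∀ u, (σ (1, u)).2 = 1
  mr0' : ∀ a, (σ (a, 1)).2 = a
  ml1 : ∀ a b u, (σ (a * b, u)).1 = (σ (a, (σ (b, u)).1)).1
  mr1 : ∀ a u v, (σ (a, u * v)).2 = (σ ((σ (a, u)).2, v)).2
  ml2 : ∀ a u v, (σ (a, u * v)).1 = (σ (a, u)).1 * (σ ((σ (a, u)).2, v)).1
  mr2 : ∀ a b u, (σ (a * b, u)).2 = (σ (a, (σ (b, u)).1)).2 * (σ (b, u)).2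
  m3 : ∀ u v, u * v = (σ (u, v)).1 * (σ (u, v)).2
  invol : ∀ p, σ (σ p) = p

namespace SymmetricSet

variable (X : SymmetricSet.{u})

/-- The left action: `X.L x y = ˣy`. -/
noncomputable def L (x : X.carrier) : Equiv.Perm X.carrier :=
  Equiv.ofBijective (fun y => (X.r (x, y)).1) (X.left_bijective x)

/-- The right action: `X.R y x = xʸ`. -/
noncomputable def R (y : X.carrier) : Equiv.Perm X.carrier :=
  Equiv.ofBijective (fun x => (X.r (x, y)).2) (X.right_bijective y)

/-- `(X, r)` is *square-free*: `r (x, x) = (x, x)`. -/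
def IsSquareFree : Prop := ∀ x, X.r (x, x) = (x, x)

/-- `r` is the flip map `(x, y) ↦ (y, x)`. (On a one-element set `r` is always the flip.) -/
def IsTrivial : Prop := ∀ x y, X.r (x, y) = (y, x)

/-! ### Identities in a solution -/

theorem r_eq (x y : X.carrier) : X.r (x, y) = (X.L x y, X.R y x) := rfl

theorem invol_left (x y : X.carrier) : X.L (X.L x y) (X.R y x) = x :=
  congrArg Prod.fst (X.invol (x, y))

theorem invol_right (x y : X.carrier) : X.R (X.R y x) (X.L x y) = y :=
  congrArg Prod.snd (X.invol (x, y))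

theorem braid_left (x y z : X.carrier) :
    X.L x (X.L y z) = X.L (X.L x y) (X.L (X.R y x) z) :=
  (congrArg Prod.fst (congrFun X.braid (x, y, z))).symm

theorem braid_right (x y z : X.carrier) :
    X.R z (X.R y x) = X.R (X.R z y) (X.R (X.L y z) x) :=
  congrArg (fun p => p.2.2) (congrFun X.braid (x, y, z))

theorem L_mul (x y : X.carrier) : X.L x * X.L y = X.L (X.L x y) * X.L (X.R y x) :=
  Equiv.ext fun z => X.braid_left x y z

theorem R_mul (y z : X.carrier) : X.R z * X.R y = X.R (X.R z y) * X.R (X.L y z) :=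
  Equiv.ext fun x => X.braid_right x y z

/-- `xʸ = L_{ˣy}⁻¹ x`. -/
theorem R_apply (x y : X.carrier) : X.R y x = (X.L (X.L x y))⁻¹ x := by
  rw [Equiv.Perm.eq_inv_iff_eq]; exact X.invol_left x y

/-- `L_x L_{x⁻¹w} = L_w L_{w⁻¹x}`. -/
theorem L_cycle (x w : X.carrier) :
    X.L x * X.L ((X.L x)⁻¹ w) = X.L w * X.L ((X.L w)⁻¹ x) := by
  have h := X.L_mul x ((X.L x)⁻¹ w)
  rw [X.R_apply] at h
  simpa using h

theorem R_fix (x : X.carrier) : X.R ((X.L x)⁻¹ x) x = (X.L x)⁻¹ x := by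
  rw [X.R_apply]; simp

theorem diag_bijective : Function.Bijective fun x : X.carrier => (X.L x)⁻¹ x := by
  constructor
  · intro x y h
    have hx := X.R_fix x
    have hy := X.R_fix y
    simp only at h
    rw [← h] at hy
    exact (X.R _).injective (hx.trans hy.symm)
  · intro y
    obtain ⟨x, hx⟩ := (X.R y).surjective y
    refine ⟨x, ?_⟩
    have h1 := X.invol_right x y
    rw [hx] at h1
    have h2 : X.L x y = x := (X.R y).injective (h1.trans hx.symm)
    change (X.L x)⁻¹ x = y
    rw [Equiv.Perm.inv_eq_iff_eq, h2]

/-- The diagonal map `x ↦ L_x⁻¹ x`. -/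
noncomputable def diag : Equiv.Perm X.carrier := Equiv.ofBijective _ X.diag_bijective

theorem diag_apply (x : X.carrier) : X.diag x = (X.L x)⁻¹ x := rfl

theorem L_diag (x : X.carrier) : X.L x (X.diag x) = x := by simp [diag_apply]

theorem L_diag_R (x y : X.carrier) : X.L y (X.diag (X.R y x)) = X.diag x := by
  have h := X.braid_left x y (X.diag (X.R y x))
  rw [X.L_diag, X.invol_left] at h
  rw [X.diag_apply x, Equiv.Perm.eq_inv_iff_eq, h]

theorem R_eq_conj (y : X.carrier) : X.R y = X.diag⁻¹ * (X.L y)⁻¹ * X.diag := by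
  ext x
  simp only [Equiv.Perm.mul_apply]
  rw [← X.L_diag_R x y]
  simp

theorem L_eq_iff (x y : X.carrier) : X.L x = X.L y ↔ X.R x = X.R y := by
  rw [R_eq_conj, R_eq_conj]; simp

/-! ### The retraction -/

/-- `x ∼ y` iff `L_x = L_y`. -/
noncomputable def retSetoid : Setoid X.carrier := Setoid.ker X.L

theorem L_L_inv {w w' : X.carrier} (h : X.L w = X.L w') (x : X.carrier) :
    X.L ((X.L x)⁻¹ w) = X.L ((X.L x)⁻¹ w') := by
  have h1 := X.L_cycle x w
  have h2 := X.L_cycle x w'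
  rw [h, ← h2] at h1
  exact mul_left_cancel h1

theorem L_left_congr {x x' y y' : X.carrier} (hx : X.L x = X.L x') (hy : X.L y = X.L y') :
    X.L (X.L x y) = X.L (X.L x' y') := by
  have h1 := X.L_mul x y
  have h2 := X.L_mul x y'
  rw [hy, h2, (X.L_eq_iff y y').1 hy] at h1
  rw [← hx]
  exact (mul_right_cancel h1).symm

theorem L_right_congr {x x' y y' : X.carrier} (hx : X.L x = X.L x') (hy : X.L y = X.L y') :
    X.L (X.R y x) = X.L (X.R y' x') := by
  rw [(X.L_eq_iff y y').1 hy, X.R_apply, X.R_apply x', ← hx]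
  exact X.L_L_inv hx _

theorem L_of_R {y y' z : X.carrier} (h : X.L (X.R z y) = X.L (X.R z y')) : X.L y = X.L y' := by
  rw [L_eq_iff] at h ⊢
  have h0 : X.L y z = X.L y' z := by
    have h1 := X.invol_right y z
    have h2 := X.invol_right y' z
    rw [← h] at h2
    exact (X.R _).injective (h1.trans h2.symm)
  have h1 := X.R_mul y z
  rw [h, h0, ← X.R_mul y' z] at h1
  exact mul_left_cancel h1

/-- The retraction `Ret(X, r) = ([X], r_{[X]})`, with `r_{[X]}([x], [y]) = ([ˣy], [xʸ])`. -/
noncomputable def Ret : SymmetricSet.{u} where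
  carrier := Quotient X.retSetoid
  nonempty := X.nonempty.map (Quotient.mk _)
  r p := (Quotient.map₂ (fun x y => (X.r (x, y)).1)
      (fun _ _ hx _ _ hy => X.L_left_congr hx hy) p.1 p.2,
    Quotient.map₂ (fun x y => (X.r (x, y)).2)
      (fun _ _ hx _ _ hy => X.L_right_congr hx hy) p.1 p.2)
  invol := by
    rintro ⟨⟨x⟩, ⟨y⟩⟩
    exact Prod.ext (congrArg (Quotient.mk _) (X.invol_left x y))
      (congrArg (Quotient.mk _) (X.invol_right x y))
  left_bijective := by
    rintro ⟨x⟩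
    constructor
    · rintro ⟨y⟩ ⟨y'⟩ h
      have h' : X.L (X.L x y) = X.L (X.L x y') := Quotient.exact h
      have h2 := X.L_L_inv h' x
      have h3 : X.L y = X.L y' := by simpa using h2
      exact Quotient.sound h3
    · rintro ⟨y⟩
      exact ⟨Quotient.mk _ ((X.L x)⁻¹ y),
        congrArg (Quotient.mk _) (Equiv.apply_symm_apply (X.L x) y)⟩
  right_bijective := by
    rintro ⟨z⟩
    constructor
    · rintro ⟨y⟩ ⟨y'⟩ h
      exact Quotient.sound (X.L_of_R (Quotient.exact h))
    · rintro ⟨y⟩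
      exact ⟨Quotient.mk _ ((X.R z)⁻¹ y),
        congrArg (Quotient.mk _) (Equiv.apply_symm_apply (X.R z) y)⟩
  braid := by
    intro r12 r23
    funext p
    obtain ⟨⟨x⟩, ⟨y⟩, ⟨z⟩⟩ := p
    have h := congrFun X.braid (x, y, z)
    exact congrArg (fun q : X.carrier × X.carrier × X.carrier =>
      ((Quotient.mk X.retSetoid q.1, Quotient.mk X.retSetoid q.2.1,
        Quotient.mk X.retSetoid q.2.2) :
        Quotient X.retSetoid × Quotient X.retSetoid × Quotient X.retSetoid)) h

/-- The iterated retraction `Retᵐ(X, r)`. -/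
noncomputable def iterRet (m : ℕ) : SymmetricSet.{u} := Ret^[m] X

/-- The multipermutation level: the least `m` such that `Retᵐ(X, r)` has exactly one element,
and `⊤` (i.e. `∞`) if there is no such `m`. -/
noncomputable def mpl : ℕ∞ :=
  ⨅ m ∈ {m : ℕ | Nat.card (X.iterRet m).carrier = 1}, (m : ℕ∞)

/-! ### The structure group and the permutation group -/

/-- The defining relations `xy = (ˣy)(xʸ)` of the structure group. -/
def structureRels : Set (FreeGroup X.carrier) :=
  {w | ∃ x y : X.carrier, w = FreeGroup.of x * FreeGroup.of y *
    (FreeGroup.of (X.r (x, y)).1 * FreeGroup.of (X.r (x, y)).2)⁻¹}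

/-- The structure group `G(X, r)`. -/
abbrev StructureGroup : Type u := PresentedGroup X.structureRels

/-- The canonical map `X → G(X, r)`. -/
def toG (x : X.carrier) : X.StructureGroup := PresentedGroup.of x

/-- The canonical homomorphism `G(X, r) → Sym(X)` extending `x ↦ L_x`. -/
noncomputable def leftHom : X.StructureGroup →* Equiv.Perm X.carrier :=
  PresentedGroup.toGroup (f := X.L) (by
    rintro w ⟨x, y, rfl⟩
    simp only [map_mul, map_inv, FreeGroup.lift_apply_of]
    rw [mul_inv_eq_one]
    exact X.L_mul x y)

/-- The permutation group `𝒢(X, r)`: the image of `G(X, r)` in `Sym(X)`. -/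
noncomputable def permGroup : Subgroup (Equiv.Perm X.carrier) := X.leftHom.range

/-- The epimorphism `G(X, r) → 𝒢(X, r)`. -/
noncomputable def toPermGroup : X.StructureGroup →* X.permGroup := X.leftHom.rangeRestrict

theorem leftHom_toG (x : X.carrier) : X.leftHom (X.toG x) = X.L x :=
  PresentedGroup.toGroup.of _

theorem toG_mul (x y : X.carrier) :
    X.toG x * X.toG y = X.toG (X.L x y) * X.toG (X.R y x) := by
  have h : PresentedGroup.mk X.structureRels (FreeGroup.of x * FreeGroup.of y *
    (FreeGroup.of (X.r (x, y)).1 * FreeGroup.of (X.r (x, y)).2)⁻¹) = 1 :=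
    PresentedGroup.one_of_mem ⟨x, y, rfl⟩
  rw [map_mul, map_inv, mul_inv_eq_one] at h
  exact h

theorem closure_toG : Subgroup.closure (Set.range X.toG) = ⊤ :=
  PresentedGroup.closure_range_of _

/-! ### The braiding operator on a group generated by the image of `X`

The following applies to `G(X, r)` and to `𝒢(X, r)`. -/

/-- A group `H` acting on `X` and generated by elements `ι x` that act as `L_x` and satisfy
`(ι x)(ι y) = ι(ˣy) ι(xʸ)`. -/
structure Gen (H : Type v) [Group H] where
  ι : X.carrier → H
  ρ : H →* Equiv.Perm X.carrier
  ρ_ι : ∀ x, ρ (ι x) = X.L x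
  rel : ∀ x y, ι x * ι y = ι (X.L x y) * ι (X.R y x)
  gen : Subgroup.closure (Set.range ι) = ⊤

namespace Gen

variable {X} {H : Type v} [Group H] (g : X.Gen H)

/-- The permutation `a ↦ a · ι(a⁻¹ y)` of `H` (addition of `ι y` in the left brace). -/
noncomputable def step (y : X.carrier) : Equiv.Perm H where
  toFun a := a * g.ι ((g.ρ a)⁻¹ y)
  invFun a := a * (g.ι (X.diag⁻¹ ((g.ρ a)⁻¹ y)))⁻¹
  left_inv a := by
    have : (g.ρ (a * g.ι ((g.ρ a)⁻¹ y)))⁻¹ y = X.diag ((g.ρ a)⁻¹ y) := by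
      simp [g.ρ_ι, diag_apply]
    simp only [this]
    simp
  right_inv a := by
    have : (g.ρ (a * (g.ι (X.diag⁻¹ ((g.ρ a)⁻¹ y)))⁻¹))⁻¹ y
        = X.diag⁻¹ ((g.ρ a)⁻¹ y) := by
      obtain ⟨u, hu⟩ := X.diag.surjective ((g.ρ a)⁻¹ y)
      have h0 : X.diag⁻¹ (X.diag u) = u := by simp
      rw [← hu, h0, map_mul, map_inv, g.ρ_ι, mul_inv_rev, inv_inv, Equiv.Perm.mul_apply, ← hu,
        X.L_diag]
    simp only [this]
    simp

theorem step_apply (y : X.carrier) (a : H) : g.step y a = a * g.ι ((g.ρ a)⁻¹ y) := rfl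

theorem ι_cycle (x w : X.carrier) :
    g.ι x * g.ι ((X.L x)⁻¹ w) = g.ι w * g.ι ((X.L w)⁻¹ x) := by
  have h := g.rel x ((X.L x)⁻¹ w)
  rw [X.R_apply] at h
  simpa using h

theorem step_comm (y z : X.carrier) : g.step y * g.step z = g.step z * g.step y := by
  ext a
  simp only [Equiv.Perm.mul_apply, step_apply, map_mul, g.ρ_ι, mul_inv_rev, mul_assoc]
  rw [g.ι_cycle]

/-- The (abelian) group generated by the permutations `step y`. -/
def Z : Subgroup (Equiv.Perm H) := Subgroup.closure (Set.range g.step)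

theorem Z_comm {σ τ : Equiv.Perm H} (hσ : σ ∈ g.Z) (hτ : τ ∈ g.Z) : σ * τ = τ * σ := by
  refine Subgroup.closure_induction₂ (p := fun x y _ _ => x * y = y * x) ?_ ?_ ?_ ?_ ?_ ?_ ?_ hσ hτ
  · rintro _ _ ⟨x, rfl⟩ ⟨y, rfl⟩; exact g.step_comm x y
  · intros; simp
  · intros; simp
  · intro x y z _ _ _ h1 h2; rw [mul_assoc, h2, ← mul_assoc, h1, mul_assoc]
  · intro x y z _ _ _ h1 h2; rw [← mul_assoc, h1, mul_assoc, h2, mul_assoc]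
  · intro x y _ _ h; exact Commute.inv_left (a := x) (b := y) h
  · intro x y _ _ h; exact Commute.inv_right (a := x) (b := y) h

theorem Z_conj (c : H) {τ : Equiv.Perm H} (hτ : τ ∈ g.Z) :
    Equiv.mulLeft c * τ * (Equiv.mulLeft c)⁻¹ ∈ g.Z := by
  refine Subgroup.closure_induction
    (p := fun τ _ => Equiv.mulLeft c * τ * (Equiv.mulLeft c)⁻¹ ∈ g.Z) ?_ ?_ ?_ ?_ hτ
  · rintro _ ⟨y, rfl⟩
    have : Equiv.mulLeft c * g.step y * (Equiv.mulLeft c)⁻¹ = g.step (g.ρ c y) := by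
      rw [mul_inv_eq_iff_eq_mul]
      ext a
      simp [step_apply, mul_assoc]
    rw [this]
    exact Subgroup.subset_closure ⟨_, rfl⟩
  · rw [mul_one, mul_inv_cancel]
    exact one_mem _
  · intro x y _ _ hx hy
    have h := mul_mem hx hy
    rwa [← mul_assoc, ← mul_assoc, inv_mul_cancel_right, mul_assoc (Equiv.mulLeft c)] at h
  · intro x _ hx
    have h := inv_mem hx
    rwa [mul_inv_rev, mul_inv_rev, inv_inv, ← mul_assoc] at h

theorem Z_trans_one (a : H) : ∃ τ ∈ g.Z, τ 1 = a := by
  have ha : a ∈ Subgroup.closure (Set.range g.ι) := by rw [g.gen]; trivial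
  induction ha using Subgroup.closure_induction_right with
  | one => exact ⟨1, one_mem _, rfl⟩
  | mul_right a _ _ hy ih =>
    obtain ⟨x, rfl⟩ := hy
    obtain ⟨τ, hτ, rfl⟩ := ih
    exact ⟨g.step (g.ρ (τ 1) x) * τ, mul_mem (Subgroup.subset_closure ⟨_, rfl⟩) hτ,
      by simp [step_apply]⟩
  | mul_inv_cancel a _ _ hy ih =>
    obtain ⟨x, rfl⟩ := hy
    obtain ⟨τ, hτ, rfl⟩ := ih
    refine ⟨(g.step (g.ρ (τ 1) (X.diag x)))⁻¹ * τ,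
      mul_mem (inv_mem (Subgroup.subset_closure ⟨_, rfl⟩)) hτ, ?_⟩
    rw [Equiv.Perm.mul_apply, Equiv.Perm.inv_eq_iff_eq, step_apply]
    simp [g.ρ_ι, X.L_diag]

theorem Z_trans (a b : H) : ∃ τ ∈ g.Z, τ a = b := by
  obtain ⟨σ, hσ, rfl⟩ := g.Z_trans_one a
  obtain ⟨τ, hτ, rfl⟩ := g.Z_trans_one b
  exact ⟨τ * σ⁻¹, mul_mem hτ (inv_mem hσ), by simp⟩

theorem Z_free {σ τ : Equiv.Perm H} (hσ : σ ∈ g.Z) (hτ : τ ∈ g.Z) {a : H} (h : σ a = τ a)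
    (b : H) : σ b = τ b := by
  obtain ⟨π, hπ, rfl⟩ := g.Z_trans a b
  have h1 := congrArg (fun f : Equiv.Perm H => f a) (g.Z_comm hσ hπ)
  have h2 := congrArg (fun f : Equiv.Perm H => f a) (g.Z_comm hτ hπ)
  simp only [Equiv.Perm.mul_apply] at h1 h2
  rw [h1, h2, h]

/-- The left action `ᵃb` of `H` on itself. -/
noncomputable def act (a b : H) : H := (g.Z_trans a (a * b)).choose 1

theorem act_eq {a b : H} {τ : Equiv.Perm H} (hτ : τ ∈ g.Z) (h : τ a = a * b) :
    g.act a b = τ 1 :=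
  g.Z_free (g.Z_trans a (a * b)).choose_spec.1 hτ
    ((g.Z_trans a (a * b)).choose_spec.2.trans h.symm) 1

/-- The braiding operator `(a, b) ↦ (ᵃb, aᵇ)`, `aᵇ = (ᵃb)⁻¹ a b`. -/
noncomputable def op (p : H × H) : H × H := (g.act p.1 p.2, (g.act p.1 p.2)⁻¹ * p.1 * p.2)

theorem act_one (a : H) : g.act a 1 = 1 := g.act_eq (one_mem _) (by simp)

theorem one_act (a : H) : g.act 1 a = a := by
  obtain ⟨τ, hτ, rfl⟩ := g.Z_trans_one a
  exact g.act_eq hτ (by simp)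

theorem mul_act (a b c : H) : g.act (a * b) c = g.act a (g.act b c) := by
  obtain ⟨τ, hτ, h⟩ := g.Z_trans b (b * c)
  have hc := g.Z_conj a hτ
  rw [g.act_eq hτ h, g.act_eq hc (b := c), g.act_eq hc]
  · simp
  · simp [h, mul_assoc]

theorem act_mul (a b c : H) :
    g.act a (b * c) = g.act a b * g.act ((g.act a b)⁻¹ * a * b) c := by
  obtain ⟨τ, hτ, h⟩ := g.Z_trans a (a * b)
  rw [g.act_eq hτ h]
  obtain ⟨σ, hσ, h'⟩ := g.Z_trans ((τ 1)⁻¹ * a * b) ((τ 1)⁻¹ * a * b * c)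
  rw [g.act_eq hσ h']
  have hc := g.Z_conj (τ 1) hσ
  rw [g.act_eq (mul_mem hc hτ)]
  · simp
  · simp only [Equiv.Perm.mul_apply, h, Equiv.Perm.inv_def, Equiv.mulLeft_symm,
      Equiv.coe_mulLeft]
    rw [← mul_assoc (τ 1)⁻¹ a b, h']
    group

theorem op_op (p : H × H) : g.op (g.op p) = p := by
  obtain ⟨a, b⟩ := p
  obtain ⟨τ, hτ, h⟩ := g.Z_trans a (a * b)
  obtain ⟨σ, hσ, h'⟩ := g.Z_trans_one a
  have key : g.act (g.act a b) ((g.act a b)⁻¹ * a * b) = a := by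
    rw [g.act_eq hτ h, g.act_eq hσ, h']
    have := congrArg (fun f : Equiv.Perm H => f 1) (g.Z_comm hσ hτ)
    simp only [Equiv.Perm.mul_apply] at this
    rw [this, h', h]
    group
  simp only [op, key]
  ext
  · rfl
  · simp [mul_assoc]

theorem op_isSymmetricGroup : IsSymmetricGroup g.op where
  bij := Function.Involutive.bijective g.op_op
  ml0 := g.act_one
  ml0' := g.one_act
  mr0 u := by simp [op, one_act]
  mr0' a := by simp [op, act_one]
  ml1 := g.mul_act
  mr1 a u v := by simp [op, act_mul, mul_assoc]
  ml2 := g.act_mul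
  mr2 a b u := by simp [op, mul_act, mul_assoc]
  m3 u v := by simp [op, mul_assoc]
  invol := g.op_op

theorem op_ι (x y : X.carrier) :
    g.op (g.ι x, g.ι y) = (g.ι (X.r (x, y)).1, g.ι (X.r (x, y)).2) := by
  have h : g.act (g.ι x) (g.ι y) = g.ι (X.L x y) := by
    rw [g.act_eq (τ := g.step (X.L x y)) (Subgroup.subset_closure ⟨_, rfl⟩)]
    · simp [step_apply]
    · simp [step_apply, g.ρ_ι]
  refine Prod.ext h ?_
  change (g.act (g.ι x) (g.ι y))⁻¹ * g.ι x * g.ι y = g.ι (X.R y x)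
  rw [h, mul_assoc, g.rel, inv_mul_cancel_left]

theorem unique_ι {σ : H × H → H × H} (hσ : IsSymmetricGroup σ)
    (h : ∀ x y, σ (g.ι x, g.ι y) = (g.ι (X.r (x, y)).1, g.ι (X.r (x, y)).2)) (a : H) :
    ∀ y, (σ (a, g.ι y)).1 = g.ι (g.ρ a y) := by
  have ha : a ∈ Subgroup.closure (Set.range g.ι) := by rw [g.gen]; trivial
  induction ha using Subgroup.closure_induction with
  | mem a ha =>
    obtain ⟨x, rfl⟩ := ha
    intro y; rw [h, g.ρ_ι]; rfl
  | one => intro y; simp [hσ.ml0']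
  | mul a b _ _ iha ihb => intro y; rw [hσ.ml1, ihb, iha]; simp
  | inv a _ ih =>
    intro y
    have h1 := ih ((g.ρ a)⁻¹ y)
    rw [show g.ρ a ((g.ρ a)⁻¹ y) = y by simp] at h1
    rw [← h1, ← hσ.ml1, inv_mul_cancel, hσ.ml0', map_inv]

theorem unique {σ τ : H × H → H × H} (hσ : IsSymmetricGroup σ) (hτ : IsSymmetricGroup τ)
    (h : ∀ x y, σ (g.ι x, g.ι y) = (g.ι (X.r (x, y)).1, g.ι (X.r (x, y)).2))
    (h' : ∀ x y, τ (g.ι x, g.ι y) = (g.ι (X.r (x, y)).1, g.ι (X.r (x, y)).2)) : σ = τ := by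
  have of_fst : ∀ p : H × H, (σ p).1 = (τ p).1 → σ p = τ p := by
    rintro ⟨a, b⟩ hp
    refine Prod.ext hp ?_
    have h1 := hσ.m3 a b
    rw [hτ.m3 a b, hp] at h1
    exact (mul_left_cancel h1).symm
  have key : ∀ b a, σ (a, b) = τ (a, b) := by
    intro b
    have hb : b ∈ Subgroup.closure (Set.range g.ι) := by rw [g.gen]; trivial
    induction hb using Subgroup.closure_induction with
    | mem b hb =>
      obtain ⟨y, rfl⟩ := hb
      intro a
      exact of_fst _ (by rw [g.unique_ι hσ h, g.unique_ι hτ h'])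
    | one => intro a; exact of_fst _ (by rw [hσ.ml0, hτ.ml0])
    | mul b c _ _ ihb ihc =>
      intro a; exact of_fst _ (by rw [hσ.ml2, hτ.ml2, ihb, ihc])
    | inv b _ ih =>
      intro a
      have e1 : (σ ((σ (a, b⁻¹)).2, b)).2 = a := by
        rw [← hσ.mr1, inv_mul_cancel, hσ.mr0']
      have h1 := hσ.ml2 (σ (a, b⁻¹)).2 b b⁻¹
      have h2 := hτ.ml2 (σ (a, b⁻¹)).2 b b⁻¹
      rw [← ih, e1, mul_inv_cancel, hτ.ml0] at h2
      rw [e1, mul_inv_cancel, hσ.ml0, h2] at h1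
      exact of_fst _ (mul_left_cancel h1).symm
  exact funext fun p => key p.2 p.1

theorem op_map {K : Type v} [Group K] (k : X.Gen K) (φ : H →* K) (hι : ∀ x, φ (g.ι x) = k.ι x)
    (hρ : ∀ a, k.ρ (φ a) = g.ρ a) (p : H × H) : k.op (p.map φ φ) = (g.op p).map φ φ := by
  have lift : ∀ τ ∈ g.Z, ∃ τ' ∈ k.Z, ∀ a, τ' (φ a) = φ (τ a) := by
    intro τ hτ
    induction hτ using Subgroup.closure_induction with
    | mem τ hτ =>
      obtain ⟨y, rfl⟩ := hτ
      exact ⟨k.step y, Subgroup.subset_closure ⟨_, rfl⟩, fun a => by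
        simp [step_apply, hι, hρ]⟩
    | one => exact ⟨1, one_mem _, fun a => rfl⟩
    | mul s t _ _ ihs iht =>
      obtain ⟨s', hs', hs⟩ := ihs
      obtain ⟨t', ht', ht⟩ := iht
      exact ⟨s' * t', mul_mem hs' ht', fun a => by simp [hs, ht]⟩
    | inv s _ ih =>
      obtain ⟨s', hs', hs⟩ := ih
      exact ⟨s'⁻¹, inv_mem hs', fun a => by rw [Equiv.Perm.inv_eq_iff_eq, hs]; simp⟩
  obtain ⟨a, b⟩ := p
  obtain ⟨τ, hτ, h⟩ := g.Z_trans a (a * b)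
  obtain ⟨τ', hτ', h'⟩ := lift τ hτ
  have e : k.act (φ a) (φ b) = φ (g.act a b) := by
    rw [g.act_eq hτ h, k.act_eq hτ' (by rw [h', h, map_mul]), ← h', map_one φ]
  simp [op, e]

end Gen

/-- `G(X, r)` is generated by the image of `X`. -/
noncomputable def genG : X.Gen X.StructureGroup where
  ι := X.toG
  ρ := X.leftHom
  ρ_ι := X.leftHom_toG
  rel := X.toG_mul
  gen := X.closure_toG

/-- `𝒢(X, r)` is generated by the permutations `L_x`. -/
noncomputable def genPerm : X.Gen X.permGroup where
  ι x := X.toPermGroup (X.toG x)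
  ρ := X.permGroup.subtype
  ρ_ι := X.leftHom_toG
  rel x y := by rw [← map_mul, X.toG_mul, map_mul]
  gen := by
    have h : Set.range (fun x => X.toPermGroup (X.toG x)) = X.toPermGroup '' Set.range X.toG := by
      rw [← Set.range_comp]; rfl
    rw [h, ← MonoidHom.map_closure, X.closure_toG, ← MonoidHom.range_eq_map]
    exact MonoidHom.range_eq_top.2 X.leftHom.rangeRestrict_surjective

/-- There is exactly one symmetric group structure on `G(X, r)` extending `r`. -/
theorem existsUnique_braidingG :
    ∃! σ : X.StructureGroup × X.StructureGroup → X.StructureGroup × X.StructureGroup,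
      IsSymmetricGroup σ ∧
        ∀ x y, σ (X.toG x, X.toG y) = (X.toG (X.r (x, y)).1, X.toG (X.r (x, y)).2) :=
  ⟨X.genG.op, ⟨X.genG.op_isSymmetricGroup, X.genG.op_ι⟩, fun _ hσ =>
    X.genG.unique hσ.1 X.genG.op_isSymmetricGroup hσ.2 X.genG.op_ι⟩

/-- The braiding operator `r_G` of the symmetric group `(G, r_G)`, `G = G(X, r)`: the unique one
extending `r`. -/
noncomputable def braidingG :
    X.StructureGroup × X.StructureGroup → X.StructureGroup × X.StructureGroup :=
  X.existsUnique_braidingG.choose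

/-- There is exactly one symmetric group structure on `𝒢(X, r)` for which the epimorphism
`G(X, r) → 𝒢(X, r)` is braiding-preserving. -/
theorem existsUnique_braidingPerm :
    ∃! σ : X.permGroup × X.permGroup → X.permGroup × X.permGroup,
      IsSymmetricGroup σ ∧
        ∀ a b, σ (X.toPermGroup a, X.toPermGroup b) =
          (X.toPermGroup (X.braidingG (a, b)).1, X.toPermGroup (X.braidingG (a, b)).2) := by
  have hG : X.genG.op = X.braidingG := X.existsUnique_braidingG.unique
    ⟨X.genG.op_isSymmetricGroup, X.genG.op_ι⟩ X.existsUnique_braidingG.choose_spec.1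
  have hop : ∀ a b, X.genPerm.op (X.toPermGroup a, X.toPermGroup b) =
      (X.toPermGroup (X.braidingG (a, b)).1, X.toPermGroup (X.braidingG (a, b)).2) := by
    intro a b
    rw [← hG]
    exact X.genG.op_map X.genPerm X.toPermGroup (fun _ => rfl) (fun _ => rfl) (a, b)
  refine ⟨X.genPerm.op, ⟨X.genPerm.op_isSymmetricGroup, hop⟩, ?_⟩
  rintro σ ⟨-, hσ⟩
  funext ⟨a, b⟩
  obtain ⟨a, rfl⟩ := X.leftHom.rangeRestrict_surjective a
  obtain ⟨b, rfl⟩ := X.leftHom.rangeRestrict_surjective b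
  exact (hσ a b).trans (hop a b).symm

/-- The braiding operator `r_𝒢` of the symmetric group `(𝒢, r_𝒢)`, `𝒢 = 𝒢(X, r)`: the one
induced from `(G, r_G)` by the epimorphism `G(X, r) → 𝒢(X, r)`. -/
noncomputable def braidingPerm : X.permGroup × X.permGroup → X.permGroup × X.permGroup :=
  X.existsUnique_braidingPerm.choose

end SymmetricSet

/-! If `𝒢_j` satisfies **lri**, the point is that each retraction strictly shrinks the permutation
group until it is trivial. The action of a symmetric group makes it a left brace: `a + b = a ·
λ_a⁻¹(b)` is an abelian group law on which `a ↦ λ_a` acts by automorphisms. A finite nontrivial left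
brace with **lri** contains `s ≠ 1` with `λ_s = 1` (`LeftBrace.exists_lam_eq_one`). In `𝒢(X, r)` one
has `λ_s(L_x) = L_{s x}`, so such an `s` acts trivially on `Ret(X, r)` and dies under the
braiding-preserving epimorphism `𝒢(X, r) → 𝒢(Ret(X, r))`. Since **lri** passes to the image,
induction on the order of the permutation group reaches a one-element retraction.

To find `s`, split the additive group as `V ⊕ W`, with `V` its `p`-primary part and `W` its
`p'`-part, and look for `e ≠ 1` with `λ_{λ_e d} = λ_d` for all `d`; then `e` itself or some `λ_e(d)
d⁻¹` serves as `s`. If `W` fixes no nonzero vector of `V`, averaging over `W` forces `V` to act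
trivially on itself, and any nonzero `e ∈ V` works. Otherwise the `p`-group `V` acts on the nonzero
`p`-group of `W`-fixed vectors, hence fixes some `e ≠ 0` there.

Conversely, if `mpl X = j + 2`, square-freeness makes `Ret^{j+1}` a trivial solution. Then `𝒢_j` is
abelian and its braiding is the flip, for which **lri** is immediate. The bound `2 ≤ mpl X` holds
for every nontrivial square-free solution. -/

/-! ### Finite left braces satisfying **lri** -/

namespace LeftBrace

variable {B : Type u} [AddCommGroup B] [Group B] {lam : B →* AddMonoid.End B}

theorem lam_mul_apply (x y z : B) : lam (x * y) z = lam x (lam y z) := by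
  rw [map_mul]
  rfl

theorem lam_one_apply (z : B) : lam 1 z = z := by
  rw [map_one, AddMonoid.End.coe_one, id_eq]

theorem lam_inv_lam (x y : B) : lam x⁻¹ (lam x y) = y := by
  rw [← lam_mul_apply, inv_mul_cancel, map_one, AddMonoid.End.coe_one, id_eq]

theorem lam_lam_inv (x y : B) : lam x (lam x⁻¹ y) = y := by
  rw [← lam_mul_apply, mul_inv_cancel, map_one, AddMonoid.End.coe_one, id_eq]

theorem one_eq_zero (h : ∀ a b, a * b = a + lam a b) : (1 : B) = 0 := by
  have h0 := h 0 0
  rw [map_zero, add_zero] at h0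
  exact (mul_eq_left.1 h0).symm

theorem inv_eq_neg (h : ∀ a b, a * b = a + lam a b) (a : B) : a⁻¹ = -lam a⁻¹ a := by
  have h0 := h a⁻¹ a
  rw [inv_mul_cancel, one_eq_zero h] at h0
  exact eq_neg_of_add_eq_zero_left h0.symm

theorem mul_lam_inv (h : ∀ a b, a * b = a + lam a b) (a c : B) : a * lam a⁻¹ c = a + c := by
  rw [h, lam_lam_inv]

/-- A `lam`-invariant additive subgroup of a left brace is a multiplicative subgroup. -/
def toSubgroup (h : ∀ a b, a * b = a + lam a b) (V : AddSubgroup B)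
    (hV : ∀ a, ∀ v ∈ V, lam a v ∈ V) : Subgroup B where
  carrier := V
  mul_mem' {a b} ha hb := by
    change a * b ∈ V
    rw [h]
    exact V.add_mem ha (hV _ _ hb)
  one_mem' := by
    change (1 : B) ∈ V
    rw [one_eq_zero h]
    exact V.zero_mem
  inv_mem' {a} ha := by
    change a⁻¹ ∈ V
    rw [inv_eq_neg h]
    exact V.neg_mem (hV _ _ ha)

/-! ### Identities forced by **lri** and the search for a socle element -/

section LRI

variable (h : ∀ a b, a * b = a + lam a b) (P : ∀ a b, lam (lam a b)⁻¹ a = lam b⁻¹ a)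

include h P

/-- Under `P` the right action is `aᵇ = λ_b⁻¹(a)`, so this is the factorization `ab = (ᵃb)(aᵇ)`.
Applying `lam` turns it into a commutation rule for the operators. -/
theorem lam_mul_lam_inv (a b : B) : lam a b * lam b⁻¹ a = a * b := by
  rw [← P, h, lam_lam_inv, h a b, add_comm]

/-- Linearization of `P`: apply it to `a + c`, whose operator factors both as `λ_a λ_{λ_a⁻¹c}` and
as `λ_c λ_{λ_c⁻¹a}`, and then to each summand separately. -/
theorem lri_add (a c b : B) :
    lam (lam (lam a⁻¹ c) b)⁻¹ a + lam (lam (lam c⁻¹ a) b)⁻¹ c = lam b⁻¹ a + lam b⁻¹ c := by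
  have h1 : lam (a + c) b = lam a (lam (lam a⁻¹ c) b) := by
    rw [← lam_mul_apply, mul_lam_inv h]
  have h2 : lam (a + c) b = lam c (lam (lam c⁻¹ a) b) := by
    rw [← lam_mul_apply, mul_lam_inv h, add_comm]
  have h3 := (map_add (lam (lam (a + c) b)⁻¹) a c).symm.trans
    ((P (a + c) b).trans (map_add (lam b⁻¹) a c))
  rw [← h3, ← P a (lam (lam a⁻¹ c) b), ← P c (lam (lam c⁻¹ a) b), ← h1, ← h2]

theorem lam_lam_of_disjoint {V W : AddSubgroup B} (hV : ∀ a, ∀ v ∈ V, lam a v ∈ V)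
    (hW : ∀ a, ∀ w ∈ W, lam a w ∈ W) (hVW : Disjoint V W) {c a : B} (hc : c ∈ W) (ha : a ∈ V)
    (b : B) : lam (lam c b) a = lam b a := by
  have key : ∀ a ∈ V, lam (lam c b)⁻¹ a = lam b⁻¹ a := by
    intro a ha
    -- With `λ_a(c)` as second summand, the inner term `λ_a⁻¹(λ_a(c))` is `c`. The identity then
    -- equates a difference in `V` with one in `W`, so both vanish.
    have h1 := lri_add h P a (lam a c) b
    rw [lam_inv_lam, add_comm (lam b⁻¹ a), ← sub_eq_sub_iff_add_eq_add] at h1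
    rw [← sub_eq_zero]
    refine (AddSubgroup.disjoint_def.1 hVW) (V.sub_mem (hV _ _ ha) (hV _ _ ha)) ?_
    rw [h1]
    exact W.sub_mem (hW _ _ (hW _ _ hc)) (hW _ _ (hW _ _ hc))
  have h2 := key _ (hV b _ ha)
  rw [lam_inv_lam] at h2
  rw [← h2, lam_lam_inv, h2]

/-- In `lri_add` the terms coming from a fixed `e` equal `e` on both sides and cancel. -/
theorem lam_lam_of_fixed {e : B} (he : ∀ b, lam b e = e) (d : B) : lam (lam e d) = lam d := by
  have key : ∀ a, lam (lam e d)⁻¹ a = lam d⁻¹ a := by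
    intro a
    have h1 := lri_add h P a e d
    rw [he, he, he] at h1
    exact add_right_cancel h1
  ext a
  have h2 := key (lam d a)
  rw [lam_inv_lam] at h2
  conv_lhs => rw [← h2]
  rw [lam_lam_inv]

omit h P in
theorem exists_lam_eq_one_of_lam_lam {e : B} (he : e ≠ 1) (h : ∀ d, lam (lam e d) = lam d) :
    ∃ s : B, s ≠ 1 ∧ lam s = 1 := by
  by_cases H : ∀ d, lam e d = d
  · exact ⟨e, he, AddMonoidHom.ext H⟩
  · push Not at H
    obtain ⟨d, hd⟩ := H
    refine ⟨lam e d * d⁻¹, fun h' => hd (mul_inv_eq_one.1 h'), ?_⟩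
    rw [map_mul, h, ← map_mul, mul_inv_cancel, map_one]

/-- Let `V` and `W` be invariant additive subgroups of coprime orders. If `W` has no nonzero fixed
points in `V`, and `ʷv` acts on `V` as `v` does, then `V` is a trivial brace. -/
theorem lam_eq_of_no_fixed [Finite B] {V W : AddSubgroup B} (hV : ∀ a, ∀ v ∈ V, lam a v ∈ V)
    (hW : ∀ a, ∀ w ∈ W, lam a w ∈ W) (hcop : (Nat.card V).Coprime (Nat.card W))
    (hWV : ∀ w ∈ W, ∀ v ∈ V, ∀ a ∈ V, lam (lam w v) a = lam v a)
    (hfix : ∀ v ∈ V, (∀ w ∈ W, lam w v = v) → v = 0) {c a : B} (hc : c ∈ V) (ha : a ∈ V) :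
    lam c a = a := by
  -- `S` consists of the elements of `V` acting trivially on `V`; the goal is `c ∈ S`.
  let S : AddSubgroup B :=
    { carrier := {s | s ∈ V ∧ ∀ a ∈ V, lam s a = a}
      zero_mem' := ⟨V.zero_mem, fun a _ => by rw [← one_eq_zero h, lam_one_apply]⟩
      add_mem' := by
        rintro s t ⟨hs, hs'⟩ ⟨ht, ht'⟩
        refine ⟨V.add_mem hs ht, fun a ha => ?_⟩
        have : s + t = s * t := by rw [h, hs' t ht]
        rw [this, lam_mul_apply, ht' a ha, hs' a ha]
      neg_mem' := by
        rintro s ⟨hs, hs'⟩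
        refine ⟨V.neg_mem hs, fun a ha => ?_⟩
        have h1 : lam s⁻¹ s = s := by
          nth_rw 2 [← hs' s hs]
          exact lam_inv_lam s s
        have h2 := inv_eq_neg h s
        rw [h1] at h2
        rw [← h2]
        nth_rw 1 [← hs' a ha]
        exact lam_inv_lam s a }
  have hS : ∀ w ∈ W, lam w c - c ∈ S := by
    intro w hw
    refine ⟨V.sub_mem (hV _ _ hc) hc, ?_⟩
    set t := lam c⁻¹ (lam w c - c) with ht
    have htV : t ∈ V := hV _ _ (V.sub_mem (hV _ _ hc) hc)
    have e1 : lam c t = lam w c - c := lam_lam_inv _ _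
    have e2 : lam w c = c * t := by rw [mul_lam_inv h, add_sub_cancel]
    -- Here `λ_w(c) = c t`, and `λ_w(c)` acts on `V` as `c` does, so `t` acts trivially.
    have e3 : ∀ a ∈ V, lam t a = a := by
      intro a ha
      have := hWV w hw c hc a ha
      rw [e2, lam_mul_apply] at this
      exact (lam_inv_lam c _).symm.trans ((congrArg (lam c⁻¹) this).trans (lam_inv_lam c a))
    have e4 : lam t⁻¹ c = c := by
      nth_rw 1 [← e3 c hc]
      exact lam_inv_lam _ _
    intro a ha
    -- Since `t` fixes `c`, this reads `λ_c(t) · c = c · t`: the difference `λ_w(c) - c = λ_c(t)` is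
    -- a conjugate of `t`, and so acts trivially on `V` too.
    have e5 := lam_mul_lam_inv h P c t
    rw [e4] at e5
    have e6 := congrArg (fun x => lam x (lam c⁻¹ a)) e5
    simp only [lam_mul_apply] at e6
    rw [e1, lam_lam_inv, e3 _ (hV _ _ ha), lam_lam_inv] at e6
    exact e6
  let Wm := toSubgroup h W hW
  let := Fintype.ofFinite Wm
  -- The sum over the orbit is `W`-fixed, hence zero. Modulo `S` every term is `c`, which gives `|W|
  -- • c ∈ S`.
  have hsum : ∑ w : Wm, lam (w : B) c = 0 := by
    refine hfix _ (V.sum_mem fun w _ => hV _ _ hc) fun w hw => ?_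
    rw [map_sum]
    refine Fintype.sum_equiv (Equiv.mulLeft (⟨w, hw⟩ : Wm)) _ _ fun x => ?_
    simp
  have h1 : Nat.card W • c ∈ S := by
    have e : Nat.card W • c = -∑ w : Wm, (lam (w : B) c - c) := by
      rw [Finset.sum_sub_distrib, hsum, Finset.sum_const, Finset.card_univ, zero_sub, neg_neg,
        ← Nat.card_eq_fintype_card]
      rfl
    rw [e]
    exact S.neg_mem (S.sum_mem fun w _ => hS w w.2)
  have h2 : Nat.card V • c = 0 := by
    have := card_nsmul_eq_zero' (x := (⟨c, hc⟩ : V))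
    exact congrArg Subtype.val this
  have h3 : c ∈ S := by
    have e := Nat.gcd_eq_gcd_ab (Nat.card V) (Nat.card W)
    rw [Nat.Coprime.gcd_eq_one hcop] at e
    have e2 : c = ((1 : ℕ) : ℤ) • c := by simp
    rw [e2, e, add_smul, mul_comm, mul_smul, mul_comm, mul_smul, natCast_zsmul, natCast_zsmul, h2,
      smul_zero, zero_add]
    exact S.zsmul_mem h1 _
  exact h3.2 a ha

/-- The cases are whether `W` has a nonzero fixed vector in `V`. Each yields `e ≠ 0` with `λ_{λ_e d}
= λ_d`, as `exists_lam_eq_one_of_lam_lam` requires. -/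
theorem exists_lam_eq_one_of_coprime [Finite B] {p n : ℕ} (hp : p.Prime) {V W : AddSubgroup B}
    (hV : ∀ a, ∀ v ∈ V, lam a v ∈ V) (hW : ∀ a, ∀ w ∈ W, lam a w ∈ W)
    (hcV : Nat.card V = p ^ n) (hV1 : V ≠ ⊥) (hcW : ¬ p ∣ Nat.card W)
    (hsup : ∀ b, ∃ v ∈ V, ∃ w ∈ W, b = v + w) :
    ∃ s : B, s ≠ 1 ∧ lam s = 1 := by
  have hcop : (Nat.card V).Coprime (Nat.card W) := by
    rw [hcV]
    exact Nat.Coprime.pow_left _ ((Nat.Prime.coprime_iff_not_dvd hp).2 hcW)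
  have hVW : Disjoint V W := AddSubgroup.disjoint_of_coprime_natCard hcop
  have hWV : ∀ w ∈ W, ∀ b, ∀ a ∈ V, lam (lam w b) a = lam b a := fun w hw b a ha =>
    lam_lam_of_disjoint h P hV hW hVW hw ha b
  have hVW' : ∀ v ∈ V, ∀ b, ∀ a ∈ W, lam (lam v b) a = lam b a := fun v hv b a ha =>
    lam_lam_of_disjoint h P hW hV hVW.symm hv ha b
  by_cases hfix : ∀ v ∈ V, (∀ w ∈ W, lam w v = v) → v = 0
  · have htriv : ∀ c ∈ V, ∀ a ∈ V, lam c a = a := fun c hc a ha =>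
      lam_eq_of_no_fixed h P hV hW hcop (fun w hw v _ a ha => hWV w hw v a ha) hfix hc ha
    obtain ⟨⟨e, heV⟩, he⟩ := (V.ne_bot_iff_exists_ne_zero).1 hV1
    refine exists_lam_eq_one_of_lam_lam (e := e) ?_ fun d => ?_
    · rw [one_eq_zero h]
      exact fun h' => he (Subtype.ext h')
    ext a
    obtain ⟨v, hv, w, hw, rfl⟩ := hsup a
    rw [map_add, map_add, hVW' _ heV _ _ hw]
    congr 1
    -- On `V`, the outer factors of `λ_{λ_e d} λ_{λ_d⁻¹ e} = λ_e λ_d` coming from `e` and `λ_d⁻¹ e`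
    -- are trivial, because both lie in `V`.
    have e1 := congrArg (fun x => lam x v) (lam_mul_lam_inv h P e d)
    simp only [lam_mul_apply] at e1
    rw [htriv _ (hV _ _ heV) _ hv, htriv _ heV _ (hV _ _ hv)] at e1
    exact e1
  · push Not at hfix
    obtain ⟨f, hfV, hf, hf0⟩ := hfix
    let F : AddSubgroup B :=
      { carrier := {v | v ∈ V ∧ ∀ w ∈ W, lam w v = v}
        zero_mem' := ⟨V.zero_mem, fun _ _ => map_zero _⟩
        add_mem' := fun hs ht => ⟨V.add_mem hs.1 ht.1, fun w hw => by
          rw [map_add, hs.2 w hw, ht.2 w hw]⟩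
        neg_mem' := fun hs => ⟨V.neg_mem hs.1, fun w hw => by rw [map_neg, hs.2 w hw]⟩ }
    -- From `λ_w λ_v = λ_{λ_w v} λ_{λ_v⁻¹ w}`: the last factor fixes `x`, and `λ_w(v)` acts on `V`
    -- as `v` does.
    have hF : ∀ v ∈ V, ∀ x ∈ F, lam v x ∈ F := by
      rintro v - x ⟨hx, hx'⟩
      refine ⟨hV _ _ hx, fun w hw => ?_⟩
      have e1 := congrArg (fun y => lam y x) (lam_mul_lam_inv h P w v)
      simp only [lam_mul_apply] at e1
      rw [hx' _ (hW _ _ hw), hWV w hw v x hx] at e1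
      exact e1.symm
    let Vm := toSubgroup h V hV
    have hVm : IsPGroup p Vm := IsPGroup.of_card hcV
    let : MulAction Vm F :=
      { smul := fun v x => ⟨lam (v : B) x, hF v v.2 x x.2⟩
        one_smul := fun x => Subtype.ext (lam_one_apply _)
        mul_smul := fun v v' x => Subtype.ext (lam_mul_apply _ _ _) }
    have hpF : p ∣ Nat.card F := by
      have h1 : Nat.card F ∣ p ^ n := hcV ▸ AddSubgroup.card_dvd_of_le fun x hx => hx.1
      obtain ⟨m, -, hm⟩ := (Nat.dvd_prime_pow hp).1 h1
      rcases m with _ | m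
      · rw [pow_zero, AddSubgroup.card_eq_one] at hm
        have : f ∈ F := ⟨hfV, hf⟩
        rw [hm] at this
        exact absurd this hf0
      · rw [hm]
        exact dvd_pow_self _ (Nat.succ_ne_zero _)
    have : Fact p.Prime := ⟨hp⟩
    -- The number of fixed points is divisible by `p`, and `0` is one of them, so there is another.
    obtain ⟨e, he, he0⟩ := hVm.exists_fixed_point_of_prime_dvd_card_of_fixed_point F hpF
      (a := (0 : F)) fun v => Subtype.ext (map_zero (lam (v : B)))
    have he' : ∀ b, lam b (e : B) = e := by
      intro b
      obtain ⟨v, hv, w, hw, rfl⟩ := hsup b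
      rw [← mul_lam_inv h, lam_mul_apply, e.2.2 _ (hW _ _ hw)]
      exact congrArg Subtype.val (he ⟨v, hv⟩)
    refine exists_lam_eq_one_of_lam_lam (e := (e : B)) ?_ (lam_lam_of_fixed h P he')
    rw [one_eq_zero h]
    exact fun h' => he0 (Subtype.ext h'.symm)

/-- A nontrivial finite left brace satisfying **lri** has a nontrivial socle. -/
theorem exists_lam_eq_one [Finite B] [Nontrivial B] : ∃ s : B, s ≠ 1 ∧ lam s = 1 := by
  have hB : 1 < Nat.card B := Finite.one_lt_card
  set p := (Nat.card B).minFac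
  have hp : p.Prime := Nat.minFac_prime hB.ne'
  have : Fact p.Prime := ⟨hp⟩
  obtain ⟨k, m, hm, hk⟩ := Nat.exists_eq_pow_mul_and_not_dvd (Nat.card_pos (α := B)).ne' p hp.ne_one
  have hk0 : k ≠ 0 := by
    rintro rfl
    rw [pow_zero, one_mul] at hk
    exact hm (hk ▸ Nat.minFac_dvd _)
  have hmem : ∀ (n : ℕ) (x : B), x ∈ (nsmulAddMonoidHom n : B →+ B).ker ↔ n • x = 0 := fun n x =>
    Iff.rfl
  have hinv : ∀ n : ℕ, ∀ a, ∀ v ∈ (nsmulAddMonoidHom n : B →+ B).ker,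
      lam a v ∈ (nsmulAddMonoidHom n : B →+ B).ker := by
    intro n a v hv
    rw [hmem] at hv ⊢
    rw [← map_nsmul, hv, map_zero]
  have hprime : ∀ (n q : ℕ), q.Prime → q ∣ Nat.card (nsmulAddMonoidHom n : B →+ B).ker → q ∣ n := by
    intro n q hq hd
    have : Fact q.Prime := ⟨hq⟩
    obtain ⟨x, hx⟩ := exists_prime_addOrderOf_dvd_card' q hd
    rw [← hx]
    exact addOrderOf_dvd_of_nsmul_eq_zero (Subtype.ext x.2)
  have hcV := Nat.eq_prime_pow_of_unique_prime_dvd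
    (n := Nat.card (nsmulAddMonoidHom (p ^ k) : B →+ B).ker) Nat.card_pos.ne'
    fun {q} hq hd => (Nat.prime_dvd_prime_iff_eq hq hp).1 (hq.dvd_of_dvd_pow (hprime _ q hq hd))
  refine exists_lam_eq_one_of_coprime h P hp (hinv (p ^ k)) (hinv m) hcV ?_
    (fun hd => hm (hprime _ p hp hd)) ?_
  · obtain ⟨x, hx⟩ := exists_prime_addOrderOf_dvd_card' (G := B) p (Nat.minFac_dvd _)
    intro hbot
    have hxV : x ∈ (nsmulAddMonoidHom (p ^ k) : B →+ B).ker :=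
      addOrderOf_dvd_iff_nsmul_eq_zero.1 (hx ▸ dvd_pow_self p hk0)
    rw [hbot, AddSubgroup.mem_bot] at hxV
    rw [hxV, addOrderOf_zero] at hx
    exact hp.one_lt.ne hx
  · intro b
    have hcop : (p ^ k).Coprime m := Nat.Coprime.pow_left _ ((Nat.Prime.coprime_iff_not_dvd hp).2 hm)
    have e := Nat.gcd_eq_gcd_ab (p ^ k) m
    rw [Nat.Coprime.gcd_eq_one hcop] at e
    have hb : (p ^ k * m) • b = 0 := hk ▸ card_nsmul_eq_zero'
    -- The Bézout relation splits `b`: the multiple of `m` is killed by `p ^ k`, and the multiple of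
    -- `p ^ k` by `m`.
    refine ⟨((m : ℤ) * Nat.gcdB (p ^ k) m) • b, ?_, (((p ^ k : ℕ) : ℤ) * Nat.gcdA (p ^ k) m) • b,
      ?_, ?_⟩
    · rw [hmem, ← natCast_zsmul, smul_smul, ← mul_assoc, mul_comm, mul_smul, ← Nat.cast_mul,
        natCast_zsmul, hb, smul_zero]
    · rw [hmem, ← natCast_zsmul, smul_smul, ← mul_assoc, mul_comm, mul_smul, ← Nat.cast_mul,
        natCast_zsmul, mul_comm m, hb, smul_zero]
    · rw [← add_smul, add_comm, ← e, Nat.cast_one, one_smul]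

end LRI

end LeftBrace

/-! ### The left brace of a symmetric group -/

namespace IsSymmetricGroup

variable {H : Type v} [Group H] {σ : H × H → H × H} (hσ : IsSymmetricGroup σ)

include hσ

theorem act_inv_act (a b : H) : (σ (a⁻¹, (σ (a, b)).1)).1 = b := by
  rw [← hσ.ml1, inv_mul_cancel, hσ.ml0']

theorem act_act_inv (a b : H) : (σ (a, (σ (a⁻¹, b)).1)).1 = b := by
  rw [← hσ.ml1, mul_inv_cancel, hσ.ml0']

/-- `aᵇ = ^{(ᵃb)⁻¹}a`. -/
theorem right_eq (a b : H) : (σ (a, b)).2 = (σ ((σ (a, b)).1⁻¹, a)).1 := by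
  have h := congrArg Prod.fst (hσ.invol (a, b))
  change (σ ((σ (a, b)).1, (σ (a, b)).2)).1 = a at h
  nth_rw 3 [← h]
  rw [hσ.act_inv_act]

theorem act_mul_act_inv (a b : H) :
    a * (σ (a⁻¹, b)).1 = b * (σ (b⁻¹, a)).1 := by
  rw [hσ.m3 a, hσ.right_eq, hσ.act_act_inv]

/-- The action is additive for `b + c = b · ^{b⁻¹}c`. -/
theorem act_add (a b c : H) :
    (σ (a, b * (σ (b⁻¹, c)).1)).1 =
      (σ (a, b)).1 * (σ ((σ (a, b)).1⁻¹, (σ (a, c)).1)).1 := by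
  have h : (σ (a, b)).2 * b⁻¹ = (σ (a, b)).1⁻¹ * a := by
    rw [mul_inv_eq_iff_eq_mul, mul_assoc, hσ.m3 a b, inv_mul_cancel_left]
  rw [hσ.ml2, ← hσ.ml1, h, hσ.ml1]

/-- The additive group `a + b = a · ^{a⁻¹}b` of a symmetric group. -/
@[reducible] def addCommGroup : AddCommGroup H :=
  letI : Add H := ⟨fun a b => a * (σ (a⁻¹, b)).1⟩
  letI : Zero H := ⟨1⟩
  letI : Neg H := ⟨fun a => (σ (a, a⁻¹)).1⟩
  { nsmul := nsmulRec
    zsmul := zsmulRec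
    add_assoc a b c := by
      change a * (σ (a⁻¹, b)).1 * (σ ((a * (σ (a⁻¹, b)).1)⁻¹, c)).1 =
        a * (σ (a⁻¹, b * (σ (b⁻¹, c)).1)).1
      rw [hσ.act_add, mul_inv_rev, hσ.ml1, mul_assoc]
    zero_add a := by
      change 1 * (σ (1⁻¹, a)).1 = a
      rw [inv_one, hσ.ml0', one_mul]
    add_zero a := by
      change a * (σ (a⁻¹, 1)).1 = a
      rw [hσ.ml0, mul_one]
    neg_add_cancel a := by
      change (σ (a, a⁻¹)).1 * (σ ((σ (a, a⁻¹)).1⁻¹, a)).1 = 1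
      rw [← hσ.act_mul_act_inv, hσ.act_inv_act, mul_inv_cancel]
    add_comm := hσ.act_mul_act_inv }

/-- A nontrivial finite symmetric group satisfying **lri** has an element `s ≠ 1` acting
trivially. -/
theorem exists_act_trivial [Finite H] [Nontrivial H] (hlri : SatisfiesLRI σ) :
    ∃ s : H, s ≠ 1 ∧ ∀ b, (σ (s, b)).1 = b := by
  let := hσ.addCommGroup
  let lam : H →* AddMonoid.End H :=
    { toFun := fun a =>
        { toFun := fun b => (σ (a, b)).1
          map_zero' := hσ.ml0 a
          map_add' := hσ.act_add a }
      map_one' := AddMonoidHom.ext hσ.ml0'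
      map_mul' := fun a b => AddMonoidHom.ext (hσ.ml1 a b) }
  have hlam : ∀ a b, lam a b = (σ (a, b)).1 := fun _ _ => rfl
  have h : ∀ a b, a * b = a + lam a b := by
    intro a b
    change a * b = a * (σ (a⁻¹, (σ (a, b)).1)).1
    rw [hσ.act_inv_act]
  have P : ∀ a b, lam (lam a b)⁻¹ a = lam b⁻¹ a := by
    intro a b
    -- At the pair `(b, λ_b⁻¹ a)`, **lri** reads `aᵇ = λ_b⁻¹(a)`; `right_eq` rewrites the left side
    -- as `λ_{λ_a b}⁻¹(a)`.
    have h1 := (hlri b (σ (b⁻¹, a)).1).1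
    rw [hσ.act_act_inv, hσ.right_eq] at h1
    exact h1
  obtain ⟨s, hs, hs'⟩ := LeftBrace.exists_lam_eq_one h P
  exact ⟨s, hs, fun b => congrArg (fun f : AddMonoid.End H => f b) hs'⟩

end IsSymmetricGroup

/-! ### The epimorphism `𝒢(X, r) → 𝒢(Ret(X, r))` and its compatibility with the braidings -/

namespace SymmetricSet

variable (X : SymmetricSet.{u})

theorem braidingPerm_eq : X.braidingPerm = X.genPerm.op := by
  have hspec := X.existsUnique_braidingPerm.choose_spec.1
  refine X.genPerm.unique hspec.1 X.genPerm.op_isSymmetricGroup (fun x y => ?_) X.genPerm.op_ι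
  have h := hspec.2 (X.toG x) (X.toG y)
  rw [show X.braidingG (X.toG x, X.toG y) = _ from X.existsUnique_braidingG.choose_spec.1.2 x y]
    at h
  exact h

theorem genPerm_ι_coe (x : X.carrier) : (X.genPerm.ι x : Equiv.Perm X.carrier) = X.L x :=
  X.leftHom_toG x

theorem genPerm_ι_eq_iff (x y : X.carrier) : X.genPerm.ι x = X.genPerm.ι y ↔ X.L x = X.L y := by
  rw [← Subtype.coe_inj, genPerm_ι_coe, genPerm_ι_coe]

theorem op_genPerm_ι (f : X.permGroup) (y : X.carrier) :
    (X.genPerm.op (f, X.genPerm.ι y)).1 = X.genPerm.ι ((f : Equiv.Perm X.carrier) y) :=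
  X.genPerm.unique_ι X.genPerm.op_isSymmetricGroup X.genPerm.op_ι f y

/-- The braiding gives `ᶠL_x = L_{f x}`, so `L_{f x}` depends only on `f` and `L_x`. This is what
lets `𝒢(X, r)` act on the retraction. -/
theorem L_perm_congr (f : X.permGroup) {x y : X.carrier} (h : X.L x = X.L y) :
    X.L ((f : Equiv.Perm X.carrier) x) = X.L ((f : Equiv.Perm X.carrier) y) := by
  rw [← genPerm_ι_eq_iff] at h ⊢
  rw [← op_genPerm_ι, ← op_genPerm_ι, h]

/-- The action of `𝒢(X, r)` on `Ret(X, r)`. -/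
noncomputable def permGroupRet : X.permGroup →* Equiv.Perm X.Ret.carrier where
  toFun f := Quotient.congr (f : Equiv.Perm X.carrier) fun x y =>
    ⟨fun h => X.L_perm_congr f h, fun h => by
      have h1 := X.L_perm_congr f⁻¹ h
      change X.L x = X.L y
      simpa using h1⟩
  map_one' := Equiv.ext fun q => Quotient.inductionOn q fun _ => rfl
  map_mul' _ _ := Equiv.ext fun q => Quotient.inductionOn q fun _ => rfl

theorem permGroupRet_mk (f : X.permGroup) (x : X.carrier) :
    X.permGroupRet f (Quotient.mk X.retSetoid x) =
      Quotient.mk X.retSetoid ((f : Equiv.Perm X.carrier) x) := rfl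

/-- `𝒢(X, r)` is generated by the image of `Ret(X, r)`. -/
noncomputable def genRet : X.Ret.Gen X.permGroup where
  ι := Quotient.lift X.genPerm.ι fun x y h => (X.genPerm_ι_eq_iff x y).2 h
  ρ := X.permGroupRet
  ρ_ι q := Quotient.inductionOn q fun x => Equiv.ext fun q' => Quotient.inductionOn q' fun y => by
    refine (X.permGroupRet_mk _ y).trans ?_
    rw [Quotient.lift_mk, genPerm_ι_coe]
    rfl
  rel q q' := Quotient.inductionOn₂ q q' fun x y => X.genPerm.rel x y
  gen := by
    rw [← X.genPerm.gen]
    congr 1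
    ext f
    exact ⟨fun ⟨q, hq⟩ => by
      obtain ⟨x, rfl⟩ := Quotient.exists_rep q
      exact ⟨x, hq⟩, fun ⟨x, hx⟩ => ⟨Quotient.mk _ x, hx⟩⟩

/-- `Gen.op_map` compares groups generated by the same solution. Viewing `𝒢(X, r)` as generated by
`Ret(X, r)` makes it comparable with `𝒢(Ret(X, r))`, and uniqueness shows that the braiding is
unchanged. -/
theorem genRet_op : X.genRet.op = X.genPerm.op :=
  X.genRet.unique X.genRet.op_isSymmetricGroup X.genPerm.op_isSymmetricGroup X.genRet.op_ι
    fun q q' => Quotient.inductionOn₂ q q' fun x y => X.genPerm.op_ι x y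

theorem permGroupRet_mem (f : X.permGroup) : X.permGroupRet f ∈ X.Ret.permGroup := by
  have h : (⊤ : Subgroup X.permGroup) ≤ X.Ret.permGroup.comap X.permGroupRet := by
    rw [← X.genRet.gen, Subgroup.closure_le]
    rintro _ ⟨q, rfl⟩
    change X.genRet.ρ _ ∈ X.Ret.permGroup
    rw [X.genRet.ρ_ι, ← genPerm_ι_coe]
    exact Subtype.coe_prop _
  exact h trivial

/-- The epimorphism `𝒢(X, r) → 𝒢(Ret(X, r))`. -/
noncomputable def toPermGroupRet : X.permGroup →* X.Ret.permGroup :=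
  X.permGroupRet.codRestrict _ X.permGroupRet_mem

theorem toPermGroupRet_ι (q : X.Ret.carrier) :
    X.toPermGroupRet (X.genRet.ι q) = X.Ret.genPerm.ι q := by
  apply Subtype.ext
  rw [genPerm_ι_coe]
  exact X.genRet.ρ_ι q

theorem toPermGroupRet_surjective : Function.Surjective X.toPermGroupRet := by
  rw [← MonoidHom.range_eq_top, eq_top_iff, ← X.Ret.genPerm.gen, Subgroup.closure_le]
  rintro _ ⟨q, rfl⟩
  exact ⟨_, X.toPermGroupRet_ι q⟩

theorem braidingPerm_map (p : X.permGroup × X.permGroup) :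
    X.Ret.braidingPerm (p.map X.toPermGroupRet X.toPermGroupRet) =
      (X.braidingPerm p).map X.toPermGroupRet X.toPermGroupRet := by
  rw [braidingPerm_eq, braidingPerm_eq, ← X.genRet_op]
  exact X.genRet.op_map X.Ret.genPerm X.toPermGroupRet X.toPermGroupRet_ι (fun _ => rfl) p

variable {X}

theorem _root_.SatisfiesLRI.ret (h : SatisfiesLRI X.braidingPerm) :
    SatisfiesLRI X.Ret.braidingPerm := by
  intro a b
  obtain ⟨a, rfl⟩ := X.toPermGroupRet_surjective a
  obtain ⟨b, rfl⟩ := X.toPermGroupRet_surjective b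
  have hm : ∀ a b, X.Ret.braidingPerm (X.toPermGroupRet a, X.toPermGroupRet b) =
      (X.toPermGroupRet (X.braidingPerm (a, b)).1, X.toPermGroupRet (X.braidingPerm (a, b)).2) :=
    fun a b => X.braidingPerm_map (a, b)
  simp only [hm, (h a b).1, (h a b).2, and_self]

instance finite_ret [Finite X.carrier] : Finite X.Ret.carrier :=
  inferInstanceAs (Finite (Quotient X.retSetoid))

theorem card_permGroup_ret_lt [Finite X.carrier] (h : SatisfiesLRI X.braidingPerm)
    (hne : X.permGroup ≠ ⊥) : Nat.card X.Ret.permGroup < Nat.card X.permGroup := by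
  have hnt : Nontrivial X.permGroup := (Subgroup.nontrivial_iff_ne_bot _).2 hne
  have hσ : IsSymmetricGroup X.braidingPerm := X.existsUnique_braidingPerm.choose_spec.1.1
  obtain ⟨s, hs1, hs⟩ := hσ.exists_act_trivial h
  have hs' : X.toPermGroupRet s = 1 := by
    refine Subtype.ext (Equiv.ext fun q => ?_)
    obtain ⟨x, rfl⟩ := Quotient.exists_rep q
    -- Trivial action on the generator `L_x` means `L_{s x} = L_x`, so `s` fixes the class of `x`.
    have h1 := hs (X.genPerm.ι x)
    rw [braidingPerm_eq, op_genPerm_ι, genPerm_ι_eq_iff] at h1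
    exact Quotient.sound h1
  refine lt_of_le_of_ne (Nat.card_le_card_of_surjective _ X.toPermGroupRet_surjective) fun e => ?_
  have hinj := ((Nat.bijective_iff_surjective_and_card _).2
    ⟨X.toPermGroupRet_surjective, e.symm⟩).1
  exact hs1 (hinj (hs'.trans (map_one _).symm))

theorem L_mem_permGroup (X : SymmetricSet.{u}) (x : X.carrier) : X.L x ∈ X.permGroup :=
  X.genPerm_ι_coe x ▸ Subtype.coe_prop _

/-! ### Iterated retractions and termination -/

theorem card_ret_eq_one_iff (X : SymmetricSet.{u}) :
    Nat.card X.Ret.carrier = 1 ↔ ∀ x y, X.L x = X.L y := by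
  rw [Nat.card_eq_one_iff_unique]
  constructor
  · rintro ⟨h, -⟩ x y
    exact Quotient.exact (h.elim (Quotient.mk X.retSetoid x) (Quotient.mk X.retSetoid y))
  · intro h
    refine ⟨⟨fun p q => ?_⟩, X.Ret.nonempty⟩
    obtain ⟨x, rfl⟩ := Quotient.exists_rep p
    obtain ⟨y, rfl⟩ := Quotient.exists_rep q
    exact Quotient.sound (h x y)

theorem iterRet_succ (X : SymmetricSet.{u}) (m : ℕ) : X.iterRet (m + 1) = (X.iterRet m).Ret :=
  Function.iterate_succ_apply' _ _ _

theorem iterRet_iterRet (X : SymmetricSet.{u}) (j k : ℕ) :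
    (X.iterRet j).iterRet k = X.iterRet (k + j) :=
  (Function.iterate_add_apply _ _ _ _).symm

instance finite_iterRet [Finite X.carrier] (m : ℕ) : Finite (X.iterRet m).carrier := by
  induction m with
  | zero => assumption
  | succ m ih => rw [iterRet_succ]; exact finite_ret

theorem exists_card_iterRet_eq_one (X : SymmetricSet.{u}) [Finite X.carrier]
    (h : SatisfiesLRI X.braidingPerm) : ∃ k, Nat.card (X.iterRet k).carrier = 1 := by
  induction hn : Nat.card X.permGroup using Nat.strong_induction_on generalizing X with
  | _ n ih =>
    by_cases hne : X.permGroup = ⊥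
    -- When the permutation group is trivial, `X` itself may have many points, so one further
    -- retraction is needed.
    · refine ⟨1, (card_ret_eq_one_iff X).2 fun x y => ?_⟩
      have hL := X.L_mem_permGroup
      simp only [hne, Subgroup.mem_bot] at hL
      rw [hL, hL]
    · obtain ⟨k, hk⟩ := ih _ (hn ▸ card_permGroup_ret_lt h hne) X.Ret h.ret rfl
      exact ⟨k + 1, hk⟩

/-! ### Square-free and trivial solutions -/

theorem IsSquareFree.ret (h : X.IsSquareFree) : X.Ret.IsSquareFree := fun q =>
  Quotient.inductionOn q fun x =>
    congrArg (fun p : X.carrier × X.carrier =>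
      (Quotient.mk X.retSetoid p.1, Quotient.mk X.retSetoid p.2)) (h x)

theorem IsSquareFree.iterRet (h : X.IsSquareFree) (m : ℕ) : (X.iterRet m).IsSquareFree := by
  induction m with
  | zero => exact h
  | succ m ih => rw [iterRet_succ]; exact ih.ret

/-- `L_x y = L_y y = y`, by square-freeness at `y`. -/
theorem IsSquareFree.L_eq_one (h : X.IsSquareFree) (hL : ∀ x y, X.L x = X.L y) (x : X.carrier) :
    X.L x = 1 := by
  ext y
  rw [hL x y]
  exact congrArg Prod.fst (h y)

theorem IsSquareFree.isTrivial (h : X.IsSquareFree) (hL : ∀ x y, X.L x = X.L y) :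
    X.IsTrivial := by
  intro x y
  rw [r_eq, R_apply, h.L_eq_one hL, h.L_eq_one hL]
  rfl

theorem two_le_mpl (h : X.IsSquareFree) (hnt : ¬ X.IsTrivial) : 2 ≤ X.mpl := by
  refine le_iInf₂ fun m hm => ?_
  have hm' : Nat.card (X.iterRet m).carrier = 1 := hm
  rcases m with _ | _ | m
  · obtain ⟨h1, -⟩ := Nat.card_eq_one_iff_unique.1 hm'
    exact absurd (h.isTrivial fun x y => by rw [show x = y from h1.elim x y]) hnt
  · exact absurd (h.isTrivial ((card_ret_eq_one_iff X).1 hm')) hnt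
  · exact_mod_cast Nat.le_add_left 2 m

/-- If `Ret(X, r)` is a trivial solution, then `𝒢(X, r)` satisfies **lri**. -/
theorem IsTrivial.satisfiesLRI (h : X.Ret.IsTrivial) : SatisfiesLRI X.braidingPerm := by
  have h1 : ∀ x y, X.genPerm.ι (X.L x y) = X.genPerm.ι y := fun x y =>
    (X.genPerm_ι_eq_iff _ _).2 (Quotient.exact (congrArg Prod.fst
      (h (Quotient.mk X.retSetoid x) (Quotient.mk X.retSetoid y))))
  have h2 : ∀ x y, X.genPerm.ι (X.R y x) = X.genPerm.ι x := fun x y =>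
    (X.genPerm_ι_eq_iff _ _).2 (Quotient.exact (congrArg Prod.snd
      (h (Quotient.mk X.retSetoid x) (Quotient.mk X.retSetoid y))))
  -- By `h1` and `h2`, the relation `L_x L_y = L_{ˣy} L_{xʸ}` becomes `L_x L_y = L_y L_x`.
  have hcomm : ∀ a b : X.permGroup, a * b = b * a := by
    have hle : (⊤ : Subgroup X.permGroup) ≤ Subgroup.center X.permGroup := by
      rw [← X.genPerm.gen]
      have hc : ∀ x, Subgroup.closure (Set.range X.genPerm.ι) ≤
          Subgroup.centralizer {X.genPerm.ι x} := by
        intro x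
        rw [Subgroup.closure_le]
        rintro _ ⟨y, rfl⟩
        rw [SetLike.mem_coe, Subgroup.mem_centralizer_singleton_iff]
        rw [X.genPerm.rel x y, h1, h2]
      rw [Subgroup.closure_le]
      rintro _ ⟨x, rfl⟩
      rw [SetLike.mem_coe, Subgroup.mem_center_iff]
      intro g
      have hg : g ∈ Subgroup.closure (Set.range X.genPerm.ι) := by rw [X.genPerm.gen]; trivial
      exact Subgroup.mem_centralizer_singleton_iff.1 (hc x hg)
    exact fun a b => Subgroup.mem_center_iff.1 (hle (Subgroup.mem_top b)) a
  have hswap : IsSymmetricGroup (Prod.swap : X.permGroup × X.permGroup → _) :=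
    { bij := Prod.swap_bijective
      ml0 := fun _ => rfl
      ml0' := fun _ => rfl
      mr0 := fun _ => rfl
      mr0' := fun _ => rfl
      ml1 := fun _ _ _ => rfl
      mr1 := fun _ _ _ => rfl
      ml2 := fun _ _ _ => rfl
      mr2 := fun _ _ _ => rfl
      m3 := hcomm
      invol := Prod.swap_swap }
  -- On an abelian group the flip is a symmetric group structure. It agrees with the braiding on
  -- generators, so uniqueness identifies the two.
  have e : X.braidingPerm = Prod.swap := by
    rw [braidingPerm_eq]
    exact X.genPerm.unique X.genPerm.op_isSymmetricGroup hswap X.genPerm.op_ι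
      fun x y => Prod.ext (h1 x y).symm (h2 x y).symm
  rw [e]
  exact fun _ _ => ⟨rfl, rfl⟩

end SymmetricSet

/-- For a finite nontrivial square-free solution `(X, r)`, one has `2 ≤ mpl X < ∞` if and only if
for some `j ≥ 0` the derived permutation group `𝒢_j = 𝒢(Retʲ(X, r))` satisfies **lri** and is
not the trivial group. -/
theorem mainTheorem9 (X : SymmetricSet.{u}) [Finite X.carrier]
    (hsf : X.IsSquareFree) (hnt : ¬ X.IsTrivial) :
    (2 ≤ X.mpl ∧ X.mpl < ⊤) ↔
      ∃ j : ℕ, SatisfiesLRI (X.iterRet j).braidingPerm ∧ (X.iterRet j).permGroup ≠ ⊥ := by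
  constructor
  · rintro ⟨h2, htop⟩
    have hex : ∃ m, Nat.card (X.iterRet m).carrier = 1 := by
      by_contra hno
      push Not at hno
      refine htop.ne (iInf₂_eq_top.2 fun m hm => absurd hm (hno m))
    classical
    -- The index is `j = mpl X - 2`: `Ret^{j+2}` being a point makes `Ret^{j+1}` trivial, while
    -- `Ret^{j+1}` not being a point makes `𝒢_j` nontrivial.
    obtain ⟨j, hj⟩ : ∃ j, Nat.find hex = j + 2 := by
      have h3 : X.mpl ≤ (Nat.find hex : ℕ∞) :=
        iInf₂_le (Nat.find hex) (Nat.find_spec hex)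
      exact ⟨Nat.find hex - 2, (Nat.sub_add_cancel (by exact_mod_cast h2.trans h3)).symm⟩
    have h1 : Nat.card (X.iterRet (j + 2)).carrier = 1 := hj ▸ Nat.find_spec hex
    have h0 : Nat.card (X.iterRet (j + 1)).carrier ≠ 1 :=
      Nat.find_min hex (hj ▸ Nat.lt_succ_self _)
    rw [SymmetricSet.iterRet_succ, SymmetricSet.iterRet_succ,
      SymmetricSet.card_ret_eq_one_iff] at h1
    rw [SymmetricSet.iterRet_succ, Ne, SymmetricSet.card_ret_eq_one_iff] at h0
    refine ⟨j, SymmetricSet.IsTrivial.satisfiesLRI ((hsf.iterRet j).ret.isTrivial h1),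
      fun hbot => h0 fun x y => ?_⟩
    have hL := (X.iterRet j).L_mem_permGroup
    simp only [hbot, Subgroup.mem_bot] at hL
    rw [hL, hL]
  · rintro ⟨j, hlri, -⟩
    refine ⟨SymmetricSet.two_le_mpl hsf hnt, ?_⟩
    obtain ⟨k, hk⟩ := (X.iterRet j).exists_card_iterRet_eq_one hlri
    rw [SymmetricSet.iterRet_iterRet] at hk
    exact lt_of_le_of_lt (iInf₂_le (k + j) hk) (ENat.natCast_lt_top _)
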